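/- Let $d\in\mathbb N$, $T\ge 0$, $x_0\in\mathbb R^d$, let $|\cdot|$ be the Euclidean norm, and consider the differential inclusion $\dot x(t)\in f(t,x(t))+M(t,x(t))$, $x(0)=x_0$, on $[0,T]$, where (A1) $f:[0,T]\times\mathbb R^d\to\mathbb R^d$ is continuous and there is a continuous function $l_f:[0,T]\to\mathbb R$ with $\langle f(t,x)-f(t,x'),x-x'\rangle\le l_f(t)|x-x'|^2$ for all $t\in[0,T]$ and $x,x'\in\mathbb R^d$; (A2) $M$ maps $[0,T]\times\mathbb R^d$ to the nonempty convex compact subsets of $\mathbb R^d$, is continuous with respect to the Hausdorff metric $\mathrm{dist}_H$, and there is a continuous function $L_M:[0,T]\to[0,\infty)$ with $\mathrm{dist}_H(M(t,x),M(t,x'))\le L_M(t)|x-x'|$ for all $t\in[0,T]$ and $x,x'\in\mathbb R^d$. Let $0=t_0<t_1<\dots<t_N=T$, put $h_n=t_{n+1}-t_n$, and assume (A3) that $l_f(t_{n+1})h_n<1$ for $n=0,\dots,N-1$. Let $\rho_0,\dots,\rho_N>0$ and $\epsilon_0,\dots,\epsilon_{N-1}>0$. For $\rho>0$ and $A\subset\mathbb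 R^d$ let $P_\rho(A)$ be the set of all points of the grid $\rho\mathbb Z^d$ whose distance to $A$ is at most $\frac{\sqrt d}{2}\rho$ (the distance to the empty set being $+\infty$). Define $$\Phi(t,x;h)=\{z\in\mathbb R^d: z\in x+hf(t+h,z)+hM(t,x)\},$$ $$\hat\Phi(t,x;h,\rho,\epsilon)=P_\rho\big(\{z\in\mathbb R^d: z\in x+hf(t+h,z)+hP_\epsilon(M(t,x))\}\big).$$ A trajectory of $\Phi$ is a sequence $y_0,\dots,y_N$ in $\mathbb R^d$ with $y_0=x_0$ and $y_{n+1}\in\Phi(t_n,y_n;h_n)$ for $n=0,\dots,N-1$. A trajectory of $\hat\Phi$ is a sequence $\hat y_0,\dots,\hat y_N$ in $\mathbb R^d$ with $\hat y_0\in P_{\rho_0}(\{x_0\})$ and $\hat y_{n+1}\in\hat\Phi(t_n,\hat y_n;h_n,\rho_{n+1},\epsilon_n)$ for $n=0,\dots,N-1$. Then for every trajectory $(y_n)_{n=0}^N$ of $\Phi$ there exists a trajectory $(\hat y_n)_{n=0}^N$ of $\hat\Phi$ such that, for all $n=0,\dots,N$, $$|y_n-\hat y_n|\le\frac{\sqrt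 d}{2}\rho_0\prod_{k=0}^{n-1}\frac{1+L_M(t_k)h_k}{1-l_f(t_{k+1})h_k}+\frac{\sqrt d}{2}\sum_{k=0}^{n-1}\left(\prod_{j=k+1}^{n-1}\frac{1+L_M(t_j)h_j}{1-l_f(t_{j+1})h_j}\right)\left(\rho_{k+1}+\frac{\epsilon_kh_k}{1-l_f(t_{k+1})h_k}\right).$$ Conversely, for every trajectory $(\hat y_n)_{n=0}^N$ of $\hat\Phi$ there exists a trajectory $(y_n)_{n=0}^N$ of $\Phi$ satisfying the same estimate for all $n=0,\dots,N$. -/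

import Mathlib

namespace SemiImplicitEuler

/-- A single-valued map `g` on `ℝ^d` is one-sided Lipschitz (OSL) with constant `l`, which may
be negative. -/
def IsOSL {d : ℕ} (l : ℝ) (g : EuclideanSpace ℝ (Fin d) → EuclideanSpace ℝ (Fin d)) : Prop :=
  ∀ x x', inner ℝ (g x - g x') (x - x') ≤ l * ‖x - x'‖ ^ 2

/-- The grid `ρ ℤ^d` in `ℝ^d`. -/
def grid (d : ℕ) (ρ : ℝ) : Set (EuclideanSpace ℝ (Fin d)) :=
  {x | ∀ i, ∃ k : ℤ, x i = ρ * (k : ℝ)}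

/-- The projection of a set to the grid `ρ ℤ^d`: all grid points whose distance to `A` is at most
`(√d / 2) ρ`. -/
def gridProj {d : ℕ} (ρ : ℝ) (A : Set (EuclideanSpace ℝ (Fin d))) :
    Set (EuclideanSpace ℝ (Fin d)) :=
  Metric.cthickening (√(d : ℝ) / 2 * ρ) A ∩ grid d ρ

/-- The solution set `{z | z ∈ x + h f(t + h, z) + h V}` for a set `V` of velocities. -/
def implicitSolutions {d : ℕ} (f : ℝ → EuclideanSpace ℝ (Fin d) → EuclideanSpace ℝ (Fin d))
    (t : ℝ) (x : EuclideanSpace ℝ (Fin d)) (h : ℝ) (V : Set (EuclideanSpace ℝ (Fin d))) :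
    Set (EuclideanSpace ℝ (Fin d)) :=
  {z | ∃ m ∈ V, z = x + h • f (t + h) z + h • m}

/-- One step `Φ(t, x; h)` of the parameterized semi-implicit Euler scheme for the
right-hand side `f + M`. `ConvexBody` is the type of nonempty convex compact sets. -/
def Phi {d : ℕ} (f : ℝ → EuclideanSpace ℝ (Fin d) → EuclideanSpace ℝ (Fin d))
    (M : ℝ → EuclideanSpace ℝ (Fin d) → ConvexBody (EuclideanSpace ℝ (Fin d)))
    (t : ℝ) (x : EuclideanSpace ℝ (Fin d)) (h : ℝ) : Set (EuclideanSpace ℝ (Fin d)) :=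
  implicitSolutions f t x h (M t x : Set (EuclideanSpace ℝ (Fin d)))

/-- One step `Φ̂(t, x; h, ρ, ε)` of the fully discretized scheme: the velocity set `M(t, x)` is
projected to the grid of mesh `ε`, and the set of solutions to the grid of mesh `ρ`. -/
def PhiHat {d : ℕ} (f : ℝ → EuclideanSpace ℝ (Fin d) → EuclideanSpace ℝ (Fin d))
    (M : ℝ → EuclideanSpace ℝ (Fin d) → ConvexBody (EuclideanSpace ℝ (Fin d)))
    (t : ℝ) (x : EuclideanSpace ℝ (Fin d)) (h ρ ε : ℝ) : Set (EuclideanSpace ℝ (Fin d)) :=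
  gridProj ρ (implicitSolutions f t x h
    (gridProj ε (M t x : Set (EuclideanSpace ℝ (Fin d)))))

/-- The step size `h_n = t_{n+1} - t_n`. -/
def step (t : ℕ → ℝ) (n : ℕ) : ℝ := t (n + 1) - t n

/-- `y_0, …, y_N` is a trajectory of `Φ` on the temporal grid `t_0, …, t_N` with initial value
`x₀` (the entries of `y` and `t` beyond `N` are irrelevant). -/
def IsTrajectory {d : ℕ} (f : ℝ → EuclideanSpace ℝ (Fin d) → EuclideanSpace ℝ (Fin d))
    (M : ℝ → EuclideanSpace ℝ (Fin d) → ConvexBody (EuclideanSpace ℝ (Fin d)))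
    (N : ℕ) (t : ℕ → ℝ) (x₀ : EuclideanSpace ℝ (Fin d))
    (y : ℕ → EuclideanSpace ℝ (Fin d)) : Prop :=
  y 0 = x₀ ∧ ∀ n < N, y (n + 1) ∈ Phi f M (t n) (y n) (step t n)

/-- `y_0, …, y_N` is a trajectory of the fully discretized scheme `Φ̂` with mesh sizes
`ρ_0, …, ρ_N` in state space and `ε_0, …, ε_{N-1}` in velocity space. -/
def IsDiscretizedTrajectory {d : ℕ}
    (f : ℝ → EuclideanSpace ℝ (Fin d) → EuclideanSpace ℝ (Fin d))
    (M : ℝ → EuclideanSpace ℝ (Fin d) → ConvexBody (EuclideanSpace ℝ (Fin d)))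
    (N : ℕ) (t : ℕ → ℝ) (ρ ε : ℕ → ℝ) (x₀ : EuclideanSpace ℝ (Fin d))
    (y : ℕ → EuclideanSpace ℝ (Fin d)) : Prop :=
  y 0 ∈ gridProj (ρ 0) {x₀} ∧
    ∀ n < N, y (n + 1) ∈ PhiHat f M (t n) (y n) (step t n) (ρ (n + 1)) (ε n)

/-- The growth factor `(1 + L_M(t_k) h_k) / (1 - l_f(t_{k+1}) h_k)` of the `k`-th step. -/
noncomputable def growth (l_f L_M : ℝ → ℝ) (t : ℕ → ℝ) (k : ℕ) : ℝ :=
  (1 + L_M (t k) * step t k) / (1 - l_f (t (k + 1)) * step t k)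

/-- The error bound at time `t_n`. -/
noncomputable def errorBound (d : ℕ) (l_f L_M : ℝ → ℝ) (t ρ ε : ℕ → ℝ) (n : ℕ) : ℝ :=
  √(d : ℝ) / 2 * ρ 0 * ∏ k ∈ Finset.range n, growth l_f L_M t k
    + √(d : ℝ) / 2 * ∑ k ∈ Finset.range n,
        (∏ j ∈ Finset.Ico (k + 1) n, growth l_f L_M t j) *
          (ρ (k + 1) + ε k * step t k / (1 - l_f (t (k + 1)) * step t k))

end SemiImplicitEuler

/-! For `0 ≤ h` and `l * h < 1`, the OSL condition makes `z ↦ z - h • g z` strongly monotone with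
constant `1 - l * h`. The implicit equation is thus solvable for every datum, and its solution
depends on the datum with Lipschitz constant `1 / (1 - l * h)`. Solvability is Browder–Minty
(`IsStronglyMonotone.surjective`), obtained by mollifying to the smooth case.

Given one trajectory, the other is built step by step. Velocities are matched through the Hausdorff
distance and the `ε`-grid, the implicit equation is solved or a preimage under the projection is
chosen, and the `ρ`-grid costs one rounding error. The resulting one-step estimate is exactly the
recursion `errorBound_succ`. -/

open Filter Topology MeasureTheory
open scoped Convolution NNReal ContDiff

namespace SemiImplicitEuler

/-! ### Strongly monotone maps in finite dimension -/

section StronglyMonotone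

variable {E : Type*} [NormedAddCommGroup E] [InnerProductSpace ℝ E]

/-- Strong monotonicity with constant `c`. -/
def IsStronglyMonotone (c : ℝ) (F : E → E) : Prop :=
  ∀ x y, c * ‖x - y‖ ^ 2 ≤ inner ℝ (F x - F y) (x - y)

theorem IsStronglyMonotone.mul_norm_sub_le {c : ℝ} {F : E → E} (hF : IsStronglyMonotone c F)
    (x y : E) : c * ‖x - y‖ ≤ ‖F x - F y‖ := by
  rcases (norm_nonneg (x - y)).eq_or_lt with h | h
  · rw [← h, mul_zero]
    exact norm_nonneg _
  · have h1 := (hF x y).trans (real_inner_le_norm _ _)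
    rw [pow_two, ← mul_assoc] at h1
    exact le_of_mul_le_mul_right h1 h

theorem IsStronglyMonotone.antilipschitzWith {c : ℝ} (hc : 0 < c) {F : E → E}
    (hF : IsStronglyMonotone c F) : AntilipschitzWith (Real.toNNReal c⁻¹) F := by
  refine AntilipschitzWith.of_le_mul_dist fun x y => ?_
  rw [Real.coe_toNNReal _ (inv_nonneg.2 hc.le), dist_eq_norm, dist_eq_norm,
    le_inv_mul_iff₀ hc]
  exact hF.mul_norm_sub_le x y

variable [FiniteDimensional ℝ E]

/-- The range is clopen. It is open by the inverse function theorem, since the derivative inherits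
the lower bound `c`; it is closed because an antilipschitz continuous map is proper here. -/
theorem IsStronglyMonotone.surjective_of_contDiff {c : ℝ} (hc : 0 < c) {F : E → E}
    (hF : IsStronglyMonotone c F) (hd : ContDiff ℝ 1 F) : Function.Surjective F := by
  have hopen : IsOpen (Set.range F) := by
    rw [isOpen_iff_mem_nhds]
    rintro _ ⟨x, rfl⟩
    have hs : HasStrictFDerivAt F (fderiv ℝ F x) x :=
      hd.contDiffAt.hasStrictFDerivAt one_ne_zero
    -- Limit of the difference quotients with increment `r⁻¹ • v` as `r → ∞`.
    have hbound : ∀ v, c * ‖v‖ ≤ ‖fderiv ℝ F x v‖ := by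
      intro v
      refine ge_of_tendsto (hs.hasFDerivAt.lim_real v).norm ?_
      filter_upwards [eventually_gt_atTop (0 : ℝ)] with r hr
      have := hF.mul_norm_sub_le (x + r⁻¹ • v) x
      rw [add_sub_cancel_left, norm_smul, Real.norm_of_nonneg (inv_nonneg.2 hr.le)] at this
      rw [norm_smul, Real.norm_of_nonneg hr.le]
      calc c * ‖v‖ = r * (c * (r⁻¹ * ‖v‖)) := by field_simp
        _ ≤ _ := mul_le_mul_of_nonneg_left this hr.le
    have hinj : Function.Injective (fderiv ℝ F x) := by
      refine (injective_iff_map_eq_zero _).2 fun v hv => ?_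
      have := hbound v
      rw [hv, norm_zero] at this
      exact norm_le_zero_iff.1 (nonpos_of_mul_nonpos_right this hc)
    have hsurj : Function.Surjective (fderiv ℝ F x) :=
      (LinearMap.injective_iff_surjective (f := (fderiv ℝ F x).toLinearMap)).1 hinj
    rw [← hs.map_nhds_eq_of_surj (LinearMap.range_eq_top.2 hsurj)]
    exact mem_map.2 (Filter.univ_mem' fun y => ⟨y, rfl⟩)
  have hclosed : IsClosed (Set.range F) := by
    refine (isProperMap_iff_tendsto_cocompact.2 ⟨hd.continuous, ?_⟩).isClosedMap.isClosed_range
    rw [← Metric.cobounded_eq_cocompact]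
    exact (hF.antilipschitzWith hc).tendsto_cobounded
  exact Set.range_eq_univ.1 (IsClopen.eq_univ ⟨hclosed, hopen⟩ (Set.range_nonempty F))

/-- Mollification averages translates of `F` against a probability density, and translation leaves
`x - y`, hence the constant `c`, unchanged. -/
theorem isStronglyMonotone_convolution [MeasurableSpace E] [BorelSpace E] {c : ℝ} {F : E → E}
    (hF : IsStronglyMonotone c F) (hFc : Continuous F) (φ : ContDiffBump (0 : E)) :
    IsStronglyMonotone c (φ.normed volume ⋆[ContinuousLinearMap.lsmul ℝ ℝ, volume] F) := by
  intro x y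
  have hint (x : E) : Integrable (fun t => φ.normed volume t • F (x - t)) volume :=
    φ.hasCompactSupport_normed.convolutionExists_left (ContinuousLinearMap.lsmul ℝ ℝ)
      φ.continuous_normed hFc.locallyIntegrable x
  have hsub : Integrable (fun t => φ.normed volume t • F (x - t) - φ.normed volume t • F (y - t))
      volume := (hint x).sub (hint y)
  simp only [convolution, ContinuousLinearMap.lsmul_apply]
  rw [← integral_sub (hint x) (hint y), real_inner_comm, ← integral_inner hsub]
  calc c * ‖x - y‖ ^ 2 = ∫ t, φ.normed volume t * (c * ‖x - y‖ ^ 2) := by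
        rw [integral_mul_const, φ.integral_normed, one_mul]
    _ ≤ _ := by
      refine integral_mono (φ.integrable_normed.mul_const _)
        (hsub.const_inner _) fun t => ?_
      have h := hF (x - t) (y - t)
      rw [sub_sub_sub_cancel_right] at h
      rw [← smul_sub, inner_smul_right, real_inner_comm]
      exact mul_le_mul_of_nonneg_left h (φ.nonneg_normed t)

/-- The Browder–Minty theorem for strongly monotone maps in finite dimension. -/
theorem IsStronglyMonotone.surjective {c : ℝ} (hc : 0 < c) {F : E → E}
    (hF : IsStronglyMonotone c F) (hFc : Continuous F) : Function.Surjective F := by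
  borelize E
  intro b
  let φ : ℕ → ContDiffBump (0 : E) := fun n =>
    ⟨1 / ((n : ℝ) + 1) / 2, 1 / ((n : ℝ) + 1), by positivity, half_lt_self (by positivity)⟩
  have hφ : Tendsto (fun n => (φ n).rOut) atTop (𝓝 0) := tendsto_one_div_add_atTop_nhds_zero_nat
  let G : ℕ → E → E := fun n =>
    (φ n).normed volume ⋆[ContinuousLinearMap.lsmul ℝ ℝ, volume] F
  have hG (n) : IsStronglyMonotone c (G n) := isStronglyMonotone_convolution hF hFc (φ n)
  have hGd (n) : ContDiff ℝ 1 (G n) :=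
    (φ n).hasCompactSupport_normed.contDiff_convolution_left _ (φ n).contDiff_normed
      hFc.locallyIntegrable
  choose z hz using fun n => (hG n).surjective_of_contDiff hc (hGd n) b
  have h0 : Tendsto (fun n => G n 0) atTop (𝓝 (F 0)) :=
    ContDiffBump.convolution_tendsto_right_of_continuous hφ hFc 0
  -- Since `c` is the same for all `n`, `c * ‖z n‖ ≤ ‖b - G n 0‖`, which is bounded because it
  -- converges.
  obtain ⟨C, hC⟩ := (h0.const_sub b).norm.bddAbove_range
  have hzC (n) : z n ∈ Metric.closedBall (0 : E) (C / c) := by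
    rw [mem_closedBall_zero_iff, le_div_iff₀' hc]
    have := (hG n).mul_norm_sub_le (z n) 0
    rw [hz, sub_zero] at this
    exact this.trans (hC ⟨n, rfl⟩)
  obtain ⟨w, -, k, hk, hkw⟩ := (isCompact_closedBall (0 : E) (C / c)).tendsto_subseq hzC
  -- The evaluation points move with `n`, so pointwise convergence is not enough; continuity of `F`
  -- at `w` gives the joint limit.
  have hlim : Tendsto (fun n => G (k n) (z (k n))) atTop (𝓝 (F w)) :=
    ContDiffBump.convolution_tendsto_right (φ := fun n => φ (k n)) (g := fun _ => F)
      (hφ.comp hk.tendsto_atTop) (Eventually.of_forall fun _ => hFc.aestronglyMeasurable)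
      ((hFc.tendsto w).comp tendsto_snd) hkw
  simp only [hz] at hlim
  exact ⟨w, tendsto_nhds_unique hlim tendsto_const_nhds⟩

end StronglyMonotone

end SemiImplicitEuler

namespace SemiImplicitEuler

/-! ### Solvability and stability of the implicit equation -/

section Implicit

variable {d : ℕ} {l h : ℝ} {g : EuclideanSpace ℝ (Fin d) → EuclideanSpace ℝ (Fin d)}

theorem IsOSL.isStronglyMonotone (hg : IsOSL l g) (hh : 0 ≤ h) :
    IsStronglyMonotone (1 - l * h) fun z => z - h • g z := by
  intro x y
  have h1 := mul_le_mul_of_nonneg_left (hg x y) hh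
  have h2 : (x - h • g x) - (y - h • g y) = (x - y) - h • (g x - g y) := by module
  rw [h2, inner_sub_left, real_inner_smul_left, real_inner_self_eq_norm_sq]
  linarith

theorem IsOSL.exists_eq_add_smul (hg : IsOSL l g) (hgc : Continuous g) (hh : 0 ≤ h)
    (hlh : l * h < 1) (a : EuclideanSpace ℝ (Fin d)) : ∃ z, z = a + h • g z := by
  obtain ⟨z, hz⟩ := (hg.isStronglyMonotone hh).surjective (sub_pos.2 hlh)
    (continuous_id.sub (hgc.const_smul h)) a
  exact ⟨z, eq_add_of_sub_eq hz⟩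

theorem IsOSL.mul_norm_sub_le (hg : IsOSL l g) (hh : 0 ≤ h)
    {a a' z z' : EuclideanSpace ℝ (Fin d)} (hz : z = a + h • g z) (hz' : z' = a' + h • g z') :
    (1 - l * h) * ‖z - z'‖ ≤ ‖a - a'‖ := by
  have := (hg.isStronglyMonotone hh).mul_norm_sub_le z z'
  rwa [sub_eq_of_eq_add hz, sub_eq_of_eq_add hz'] at this

end Implicit

/-! ### Projection to grids -/

section Grid

variable {d : ℕ}

theorem exists_mem_grid_norm_sub_le {ρ : ℝ} (hρ : 0 < ρ) (x : EuclideanSpace ℝ (Fin d)) :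
    ∃ p ∈ grid d ρ, ‖x - p‖ ≤ √(d : ℝ) / 2 * ρ := by
  refine ⟨WithLp.toLp 2 fun i => ρ * (round (x i / ρ) : ℝ), fun i => ⟨_, rfl⟩, ?_⟩
  rw [EuclideanSpace.norm_eq]
  refine (Real.sqrt_le_sqrt (Finset.sum_le_sum (g := fun _ => (ρ / 2) ^ 2) fun i _ => ?_)).trans ?_
  · refine pow_le_pow_left₀ (norm_nonneg _) ?_ 2
    have h1 : x i - ρ * (round (x i / ρ) : ℝ) = ρ * (x i / ρ - round (x i / ρ)) := by
      field_simp
    rw [PiLp.sub_apply, h1, Real.norm_eq_abs, abs_mul, abs_of_pos hρ]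
    have := mul_le_mul_of_nonneg_left (abs_sub_round (x i / ρ)) hρ.le
    linarith
  · rw [Finset.sum_const, Finset.card_univ, Fintype.card_fin, nsmul_eq_mul,
      Real.sqrt_mul (Nat.cast_nonneg d), Real.sqrt_sq (by positivity)]
    exact le_of_eq (by ring)

theorem isClosed_grid (ρ : ℝ) : IsClosed (grid d ρ) := by
  have h : IsClosed (Set.range fun k : ℤ => ρ * (k : ℝ)) := by
    rcases eq_or_ne ρ 0 with rfl | hρ
    · simp
    · have := (Homeomorph.mulLeft₀ ρ hρ).isClosedMap _ Int.isClosedEmbedding_coe_real.isClosed_range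
      rwa [← Set.range_comp] at this
  have h2 : grid d ρ = ⋂ i, (fun x : EuclideanSpace ℝ (Fin d) => x i) ⁻¹'
      Set.range fun k : ℤ => ρ * (k : ℝ) := by
    ext x
    simp [grid, eq_comm]
  rw [h2]
  exact isClosed_iInter fun i => h.preimage (by fun_prop)

theorem isClosed_gridProj (ρ : ℝ) (A : Set (EuclideanSpace ℝ (Fin d))) :
    IsClosed (gridProj ρ A) :=
  Metric.isClosed_cthickening.inter (isClosed_grid ρ)

theorem exists_mem_gridProj_norm_sub_le {ρ : ℝ} (hρ : 0 < ρ) {A : Set (EuclideanSpace ℝ (Fin d))}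
    {a : EuclideanSpace ℝ (Fin d)} (ha : a ∈ A) :
    ∃ p ∈ gridProj ρ A, ‖a - p‖ ≤ √(d : ℝ) / 2 * ρ := by
  obtain ⟨p, hp, hap⟩ := exists_mem_grid_norm_sub_le hρ a
  refine ⟨p, ⟨Metric.mem_cthickening_of_dist_le p a _ A ha ?_, hp⟩, hap⟩
  rwa [dist_comm, dist_eq_norm]

/-- Closedness of `A` makes the distance attained; `A` is nonempty since the distance to the empty
set is infinite. -/
theorem exists_norm_sub_le_of_mem_gridProj {ρ : ℝ} (hρ : 0 ≤ ρ)
    {A : Set (EuclideanSpace ℝ (Fin d))} (hA : IsClosed A) {p : EuclideanSpace ℝ (Fin d)}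
    (hp : p ∈ gridProj ρ A) : ∃ a ∈ A, ‖a - p‖ ≤ √(d : ℝ) / 2 * ρ := by
  have hr : 0 ≤ √(d : ℝ) / 2 * ρ := by positivity
  have hp1 := Metric.mem_cthickening_iff.1 hp.1
  have hne : A.Nonempty := by
    rw [Set.nonempty_iff_ne_empty]
    rintro rfl
    simp at hp1
  obtain ⟨a, ha, hpa⟩ := hA.exists_infDist_eq_dist hne p
  refine ⟨a, ha, ?_⟩
  rw [← dist_eq_norm, dist_comm, ← hpa]
  exact ENNReal.toReal_le_of_le_ofReal hr hp1

/-- For `h ≠ 0` the velocity is a continuous function of `z`, so the set is a preimage of `V`. This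
is what lets a projected point be traced back to an exact solution. -/
theorem isClosed_implicitSolutions
    {f : ℝ → EuclideanSpace ℝ (Fin d) → EuclideanSpace ℝ (Fin d)} {t h : ℝ} (hh : h ≠ 0)
    (hf : Continuous (f (t + h))) (x : EuclideanSpace ℝ (Fin d))
    {V : Set (EuclideanSpace ℝ (Fin d))} (hV : IsClosed V) :
    IsClosed (implicitSolutions f t x h V) := by
  have : implicitSolutions f t x h V = (fun z => h⁻¹ • (z - (x + h • f (t + h) z))) ⁻¹' V := by
    ext z
    constructor
    · rintro ⟨m, hm, hz⟩
      rw [Set.mem_preimage, sub_eq_of_eq_add' hz, inv_smul_smul₀ hh]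
      exact hm
    · intro hz
      exact ⟨_, hz, by rw [smul_inv_smul₀ hh]; abel⟩
  rw [this]
  exact hV.preimage (by fun_prop)

end Grid

/-! ### Selections, recursion and the one-step estimate -/

theorem exists_norm_sub_le_dist {V : Type*} [NormedAddCommGroup V] [NormedSpace ℝ V]
    {K L : ConvexBody V} {m : V} (hm : m ∈ K) : ∃ m' ∈ L, ‖m - m'‖ ≤ dist K L := by
  obtain ⟨m', hm', h⟩ := L.isCompact.exists_infDist_eq_dist L.nonempty m
  refine ⟨m', hm', ?_⟩
  rw [← dist_eq_norm, ← h, ← ConvexBody.hausdorffDist_coe]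
  exact Metric.infDist_le_hausdorffDist_of_mem hm ConvexBody.hausdorffEDist_ne_top

theorem exists_seq_of_step {α : Type*} {N : ℕ} {P : ℕ → α → Prop} {R : ℕ → α → α → Prop}
    {a₀ : α} (h0 : P 0 a₀) (hs : ∀ n < N, ∀ a, P n a → ∃ b, R n a b ∧ P (n + 1) b) :
    ∃ u : ℕ → α, u 0 = a₀ ∧ (∀ n < N, R n (u n) (u (n + 1))) ∧ ∀ n ≤ N, P n (u n) := by
  -- Moving the premises behind the existential lets choice produce a total successor map; outside
  -- them the value `a` is arbitrary.
  have hs' : ∀ n a, ∃ b, n < N → P n a → R n a b ∧ P (n + 1) b := by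
    intro n a
    by_cases h : n < N ∧ P n a
    · obtain ⟨b, hb⟩ := hs n h.1 a h.2
      exact ⟨b, fun _ _ => hb⟩
    · exact ⟨a, fun h1 h2 => absurd ⟨h1, h2⟩ h⟩
  choose next hnext using hs'
  let u : ℕ → α := fun n => Nat.rec a₀ next n
  have hP : ∀ n ≤ N, P n (u n) := by
    intro n
    induction n with
    | zero => exact fun _ => h0
    | succ k ih => exact fun hk => (hnext k (u k) hk (ih (Nat.le_of_succ_le hk))).2
  exact ⟨u, rfl, fun n hn => (hnext n (u n) hn (hP n hn.le)).1, hP⟩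

theorem errorBound_zero (d : ℕ) (l_f L_M : ℝ → ℝ) (t ρ ε : ℕ → ℝ) :
    errorBound d l_f L_M t ρ ε 0 = √(d : ℝ) / 2 * ρ 0 := by
  simp [errorBound]

/-- Every old term gains the factor `growth l_f L_M t n`; the new term `k = n` carries an empty
product. -/
theorem errorBound_succ (d : ℕ) (l_f L_M : ℝ → ℝ) (t ρ ε : ℕ → ℝ) (n : ℕ) :
    errorBound d l_f L_M t ρ ε (n + 1) =
      growth l_f L_M t n * errorBound d l_f L_M t ρ ε n +
        √(d : ℝ) / 2 * (ρ (n + 1) + ε n * step t n / (1 - l_f (t (n + 1)) * step t n)) := by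
  have h : ∀ k ∈ Finset.range n,
      (∏ j ∈ Finset.Ico (k + 1) (n + 1), growth l_f L_M t j) *
          (ρ (k + 1) + ε k * step t k / (1 - l_f (t (k + 1)) * step t k)) =
        growth l_f L_M t n * ((∏ j ∈ Finset.Ico (k + 1) n, growth l_f L_M t j) *
          (ρ (k + 1) + ε k * step t k / (1 - l_f (t (k + 1)) * step t k))) := by
    intro k hk
    rw [Finset.prod_Ico_succ_top (Finset.mem_range.1 hk)]
    ring
  unfold errorBound
  rw [Finset.sum_range_succ, Finset.sum_congr rfl h, ← Finset.mul_sum, Finset.prod_range_succ,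
    Finset.Ico_self, Finset.prod_empty]
  ring

/-- One step of the error estimate for two implicit solutions with nearby data. -/
theorem IsOSL.norm_sub_le_of_eq_add_smul {d : ℕ} {l h L e δ : ℝ}
    {g : EuclideanSpace ℝ (Fin d) → EuclideanSpace ℝ (Fin d)} (hg : IsOSL l g) (hh : 0 ≤ h)
    (hlh : l * h < 1) (hL : 0 ≤ L) {x x' m₁ m₂ m₃ z z' : EuclideanSpace ℝ (Fin d)}
    (hx : ‖x - x'‖ ≤ e) (hm : ‖m₁ - m₂‖ ≤ L * ‖x - x'‖) (hm' : ‖m₂ - m₃‖ ≤ δ)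
    (hz : z = x + h • g z + h • m₁) (hz' : z' = x' + h • g z' + h • m₃) :
    ‖z - z'‖ ≤ (1 + L * h) / (1 - l * h) * e + δ * h / (1 - l * h) := by
  -- The explicit velocity is absorbed into the datum, `x + h • m₁` against `x' + h • m₃`, so only
  -- `g` remains implicit.
  have h1 := hg.mul_norm_sub_le hh (hz.trans (add_right_comm _ _ _))
    (hz'.trans (add_right_comm _ _ _))
  have h2 : x + h • m₁ - (x' + h • m₃) = (x - x') + h • ((m₁ - m₂) + (m₂ - m₃)) := by module
  have h3 : ‖(m₁ - m₂) + (m₂ - m₃)‖ ≤ L * e + δ :=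
    (norm_add_le _ _).trans (add_le_add (hm.trans (mul_le_mul_of_nonneg_left hx hL)) hm')
  have h4 : ‖x + h • m₁ - (x' + h • m₃)‖ ≤ e + h * (L * e + δ) := by
    rw [h2]
    refine (norm_add_le _ _).trans (add_le_add hx ?_)
    rw [norm_smul, Real.norm_of_nonneg hh]
    exact mul_le_mul_of_nonneg_left h3 hh
  rw [div_mul_eq_mul_div, ← add_div, le_div_iff₀' (sub_pos.2 hlh)]
  linarith

end SemiImplicitEuler

theorem proposition22 (d : ℕ) (T : ℝ)
    (f : ℝ → EuclideanSpace ℝ (Fin d) → EuclideanSpace ℝ (Fin d))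
    (M : ℝ → EuclideanSpace ℝ (Fin d) → ConvexBody (EuclideanSpace ℝ (Fin d)))
    (l_f L_M : ℝ → ℝ)
    (hf : ContinuousOn (fun p : ℝ × EuclideanSpace ℝ (Fin d) => f p.1 p.2)
      (Set.Icc 0 T ×ˢ Set.univ))
    (hlf : ContinuousOn l_f (Set.Icc 0 T))
    (hosl : ∀ s ∈ Set.Icc 0 T, SemiImplicitEuler.IsOSL (l_f s) (f s))
    (hM : ContinuousOn (fun p : ℝ × EuclideanSpace ℝ (Fin d) => M p.1 p.2)
      (Set.Icc 0 T ×ˢ Set.univ))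
    (hLM : ContinuousOn L_M (Set.Icc 0 T))
    (hLM_nonneg : ∀ s ∈ Set.Icc 0 T, 0 ≤ L_M s)
    (hlip : ∀ s ∈ Set.Icc 0 T, ∀ x x' : EuclideanSpace ℝ (Fin d),
      dist (M s x) (M s x') ≤ L_M s * ‖x - x'‖)
    (N : ℕ) (t : ℕ → ℝ) (ht_zero : t 0 = 0) (ht_last : t N = T)
    (ht_lt : ∀ n < N, t n < t (n + 1))
    (hstep : ∀ n < N, l_f (t (n + 1)) * SemiImplicitEuler.step t n < 1)
    (ρ ε : ℕ → ℝ) (hρ : ∀ n ≤ N, 0 < ρ n) (hε : ∀ n < N, 0 < ε n)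
    (x₀ : EuclideanSpace ℝ (Fin d)) :
    (∀ y : ℕ → EuclideanSpace ℝ (Fin d),
      SemiImplicitEuler.IsTrajectory f M N t x₀ y →
        ∃ y' : ℕ → EuclideanSpace ℝ (Fin d),
          SemiImplicitEuler.IsDiscretizedTrajectory f M N t ρ ε x₀ y' ∧
            ∀ n ≤ N, ‖y n - y' n‖ ≤ SemiImplicitEuler.errorBound d l_f L_M t ρ ε n) ∧
    (∀ y' : ℕ → EuclideanSpace ℝ (Fin d),
      SemiImplicitEuler.IsDiscretizedTrajectory f M N t ρ ε x₀ y' →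
        ∃ y : ℕ → EuclideanSpace ℝ (Fin d),
          SemiImplicitEuler.IsTrajectory f M N t x₀ y ∧
            ∀ n ≤ N, ‖y n - y' n‖ ≤ SemiImplicitEuler.errorBound d l_f L_M t ρ ε n) := by
  have htmono : ∀ n ≤ N, ∀ m ≤ n, t m ≤ t n := by
    intro n
    induction n with
    | zero => intro _ m hm; rw [Nat.le_zero.1 hm]
    | succ k ih =>
      intro hk m hm
      rcases Nat.le_succ_iff.1 hm with h | rfl
      · exact (ih (Nat.le_of_succ_le hk) m h).trans (ht_lt k hk).le
      · exact le_rfl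
  have htmem : ∀ n ≤ N, t n ∈ Set.Icc 0 T := fun n hn =>
    ⟨ht_zero ▸ htmono n hn 0 n.zero_le, ht_last ▸ htmono N le_rfl n hn⟩
  have hpos : ∀ n < N, 0 < SemiImplicitEuler.step t n := fun n hn => sub_pos.2 (ht_lt n hn)
  have hadd : ∀ n, t n + SemiImplicitEuler.step t n = t (n + 1) := fun n => add_sub_cancel _ _
  have hcont : ∀ n < N, Continuous (f (t (n + 1))) := fun n hn =>
    hf.comp_continuous (Continuous.prodMk_right _) fun x => ⟨htmem _ hn, trivial⟩
  -- Here `z` is the exact step, `z'` the solution with grid velocity and `p` its projection; both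
  -- directions end with this triangle inequality, with `δ = √d / 2 * ε n`.
  have hfinal : ∀ n (z z' p : EuclideanSpace ℝ (Fin d)),
      ‖z - z'‖ ≤ (1 + L_M (t n) * SemiImplicitEuler.step t n) /
            (1 - l_f (t (n + 1)) * SemiImplicitEuler.step t n) *
            SemiImplicitEuler.errorBound d l_f L_M t ρ ε n +
          √(d : ℝ) / 2 * ε n * SemiImplicitEuler.step t n /
            (1 - l_f (t (n + 1)) * SemiImplicitEuler.step t n) →
      ‖z' - p‖ ≤ √(d : ℝ) / 2 * ρ (n + 1) →
      ‖z - p‖ ≤ SemiImplicitEuler.errorBound d l_f L_M t ρ ε (n + 1) := by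
    intro n z z' p h1 h2
    refine (norm_sub_le_norm_sub_add_norm_sub z z' p).trans ((add_le_add h1 h2).trans_eq ?_)
    rw [SemiImplicitEuler.errorBound_succ, SemiImplicitEuler.growth]
    ring
  constructor
  · rintro y ⟨hy0, hy⟩
    obtain ⟨a₀, ha₀, hya₀⟩ := SemiImplicitEuler.exists_mem_gridProj_norm_sub_le
      (hρ 0 N.zero_le) (Set.mem_singleton x₀)
    obtain ⟨u, hu0, hu, hue⟩ := SemiImplicitEuler.exists_seq_of_step (N := N)
      (P := fun n a => ‖y n - a‖ ≤ SemiImplicitEuler.errorBound d l_f L_M t ρ ε n)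
      (R := fun n a b => b ∈ SemiImplicitEuler.PhiHat f M (t n) a (SemiImplicitEuler.step t n)
        (ρ (n + 1)) (ε n)) (a₀ := a₀)
      (by rwa [hy0, SemiImplicitEuler.errorBound_zero]) (by
        intro n hn a ha
        -- The velocity `m₁` of `y` is moved into `M (t n) a` as `m₂`, rounded to `m₃`, and used to
        -- solve for `z'`, which is rounded to `b`.
        obtain ⟨m₁, hm₁, hz⟩ := hy n hn
        obtain ⟨m₂, hm₂, h12⟩ := SemiImplicitEuler.exists_norm_sub_le_dist (L := M (t n) a) hm₁
        obtain ⟨m₃, hm₃, h23⟩ := SemiImplicitEuler.exists_mem_gridProj_norm_sub_le (hε n hn) hm₂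
        have hg := hosl _ (htmem _ hn)
        obtain ⟨z', hz'⟩ := hg.exists_eq_add_smul (hcont n hn) (hpos n hn).le (hstep n hn)
          (a + SemiImplicitEuler.step t n • m₃)
        rw [add_right_comm] at hz'
        rw [hadd] at hz
        obtain ⟨b, hb, hzb⟩ := SemiImplicitEuler.exists_mem_gridProj_norm_sub_le
          (hρ (n + 1) hn) (A := SemiImplicitEuler.implicitSolutions f (t n) a
            (SemiImplicitEuler.step t n) (SemiImplicitEuler.gridProj (ε n) (M (t n) a)))
          ⟨m₃, hm₃, by rw [hadd]; exact hz'⟩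
        exact ⟨b, hb, hfinal n _ _ _ (hg.norm_sub_le_of_eq_add_smul (hpos n hn).le (hstep n hn)
          (hLM_nonneg _ (htmem n hn.le)) ha (h12.trans (hlip _ (htmem n hn.le) _ _)) h23 hz hz')
          hzb⟩)
    exact ⟨u, ⟨hu0 ▸ ha₀, hu⟩, hue⟩
  · rintro y' ⟨hy0, hy⟩
    obtain ⟨a₀, rfl, hya₀⟩ := SemiImplicitEuler.exists_norm_sub_le_of_mem_gridProj
      (hρ 0 N.zero_le).le isClosed_singleton hy0
    obtain ⟨u, hu0, hu, hue⟩ := SemiImplicitEuler.exists_seq_of_step (N := N)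
      (P := fun n a => ‖a - y' n‖ ≤ SemiImplicitEuler.errorBound d l_f L_M t ρ ε n)
      (R := fun n a b => b ∈ SemiImplicitEuler.Phi f M (t n) a (SemiImplicitEuler.step t n))
      (a₀ := a₀) (by rwa [SemiImplicitEuler.errorBound_zero]) (by
        intro n hn a ha
        have hgc := hcont n hn
        have hg := hosl _ (htmem _ hn)
        -- The chain runs backwards: both projections are undone to reach `m₂`, which is moved into
        -- `M (t n) a` as `m₁`, and the exact step `z` is solved for.
        obtain ⟨z', ⟨m₃, hm₃, hz'⟩, hzb⟩ := SemiImplicitEuler.exists_norm_sub_le_of_mem_gridProj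
          (hρ (n + 1) hn).le
          (SemiImplicitEuler.isClosed_implicitSolutions (hpos n hn).ne' (by rwa [hadd]) _
            (SemiImplicitEuler.isClosed_gridProj _ _)) (hy n hn)
        obtain ⟨m₂, hm₂, h23⟩ := SemiImplicitEuler.exists_norm_sub_le_of_mem_gridProj
          (hε n hn).le (M (t n) (y' n)).isClosed hm₃
        obtain ⟨m₁, hm₁, h21⟩ := SemiImplicitEuler.exists_norm_sub_le_dist (L := M (t n) a) hm₂
        obtain ⟨z, hz⟩ := hg.exists_eq_add_smul hgc (hpos n hn).le (hstep n hn)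
          (a + SemiImplicitEuler.step t n • m₁)
        rw [add_right_comm] at hz
        rw [hadd] at hz'
        rw [norm_sub_rev, dist_comm] at h21
        exact ⟨z, ⟨m₁, hm₁, by rw [hadd]; exact hz⟩,
          hfinal n _ _ _ (hg.norm_sub_le_of_eq_add_smul (hpos n hn).le (hstep n hn)
          (hLM_nonneg _ (htmem n hn.le)) ha (h21.trans (hlip _ (htmem n hn.le) _ _)) h23 hz hz')
          hzb⟩)
    exact ⟨u, ⟨hu0, hu⟩, hue⟩
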